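/- Let $\Phi$ be the standard normal distribution function, with $\Phi^{-1}(0)=-\infty$ and $\Phi^{-1}(1)=+\infty$. For $\rho\in(-1,1)$ let $$\Phi_2(s,t;\rho)=\int_{-\infty}^{s}\int_{-\infty}^{t}\frac{1}{2\pi\sqrt{1-\rho^2}}\exp\left\{-\frac{x^2-2\rho xy+y^2}{2(1-\rho^2)}\right\}dy\,dx ,$$ and let $C_\rho(u,v)=\Phi_2(\Phi^{-1}(u),\Phi^{-1}(v);\rho)$, $0\le u,v\le 1$, be the bivariate Gaussian copula. A function $\varphi:[0,1]\to[0,1]$ is called admissible if $\varphi(u)\in[u^2,1]$ for every $u\in[0,1]$, and both $\varphi(u)\to0$ and $u^2/\varphi(u)\to0$ as $u\downarrow0$. The path $(\varphi(u),u^2/\varphi(u))_{0\le u\le1}$ of an admissible $\varphi$ is called an admissible path (its second coordinate at $u=0$ is taken to be $0$). An admissible function $\varphi^*$ is called a function of maximal dependence, and its path a path of maximal dependence, if for every $u\in(0,1)$ $$C_\rho\big(\varphi^*(u),u^2/\varphi^*(u)\big)=\max_{\varphi}\,C_\rho\big(\varphi(u),u^2/\varphi(u)\big),$$ the maximum being over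 all admissible functions $\varphi$. **Theorem.** For the Gaussian copula $C_\rho$: (I) if $\rho\in(-1,0)$, there is no admissible path of maximal dependence; (II) if $\rho=0$, every admissible path is a path of maximal dependence; (III) if $\rho\in(0,1)$, the only path of maximal dependence is the diagonal $(u,u)_{0\le u\le 1}$. That is, the diagonal is a path of maximal dependence, and every path of maximal dependence coincides with it at every $u\in(0,1]$ (the conditions put no constraint on the value $\varphi(0)\in[0,1]$, which is immaterial). -/

import Mathlib

open MeasureTheory ProbabilityTheory Set Filter Topology

noncomputable section

namespace TailDependence

/-- The standard normal distribution function `Φ`. -/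
def stdNormalCDF (x : ℝ) : ℝ := cdf (gaussianReal 0 1) x

/-- The quantile function `Φ⁻¹ : [0, 1] → [-∞, ∞]` of the standard normal law,
`Φ⁻¹(p) = inf {x ∈ ℝ | p ≤ Φ(x)}`. On `(0, 1)` it is the inverse of `Φ`, and
`Φ⁻¹(0) = -∞`, `Φ⁻¹(1) = ∞` (infimum of all of `ℝ`, infimum of the empty set). -/
def stdNormalQuantile (p : ℝ) : EReal :=
  sInf ((fun x : ℝ => (x : EReal)) '' {x : ℝ | p ≤ stdNormalCDF x})

/-- The density of the centred bivariate normal law with unit variances and correlation `ρ`. -/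
def bivariateNormalDensity (ρ x y : ℝ) : ℝ :=
  1 / (2 * Real.pi * Real.sqrt (1 - ρ ^ 2)) *
    Real.exp (-((x ^ 2 - 2 * ρ * x * y + y ^ 2) / (2 * (1 - ρ ^ 2))))

/-- The distribution function `Φ₂(s, t; ρ)` of that law,
`∫_{-∞}^s ∫_{-∞}^t density dy dx`, for `s, t ∈ [-∞, ∞]`. -/
def bivariateNormalCDF (ρ : ℝ) (s t : EReal) : ℝ :=
  ∫ x in {x : ℝ | (x : EReal) ≤ s}, ∫ y in {y : ℝ | (y : EReal) ≤ t},
    bivariateNormalDensity ρ x y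

/-- The Gaussian copula `C_ρ(u, v) = Φ₂(Φ⁻¹(u), Φ⁻¹(v); ρ)` for `u, v ∈ [0, 1]`. -/
def gaussianCopula (ρ u v : ℝ) : ℝ :=
  bivariateNormalCDF ρ (stdNormalQuantile u) (stdNormalQuantile v)

/-- Admissible functions `φ : [0, 1] → [0, 1]` (only the values on `[0, 1]` matter). -/
structure IsAdmissible (φ : ℝ → ℝ) : Prop where
  mem_Icc : ∀ u ∈ Icc (0 : ℝ) 1, φ u ∈ Icc (u ^ 2) 1
  tendsto_fst : Tendsto φ (𝓝[>] 0) (𝓝 0)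
  tendsto_snd : Tendsto (fun u => u ^ 2 / φ u) (𝓝[>] 0) (𝓝 0)

/-- The path `u ↦ (φ(u), u² / φ(u))`. For admissible `φ` and `u ∈ (0, 1]` the denominator is
positive; at `u = 0` the second coordinate is `0`. -/
def pathOf (φ : ℝ → ℝ) (u : ℝ) : ℝ × ℝ := (φ u, u ^ 2 / φ u)

/-- The probability `Π_φ(u) = C(φ(u), u² / φ(u))`. -/
def pathProb (C : ℝ → ℝ → ℝ) (φ : ℝ → ℝ) (u : ℝ) : ℝ := C (φ u) (u ^ 2 / φ u)

/-- An admissible `φ` is a function of maximal dependence for `C` if, for every `u ∈ (0, 1)`,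
it maximizes `Π_φ(u)` among all admissible functions. -/
def IsMaximalDependence (C : ℝ → ℝ → ℝ) (φ : ℝ → ℝ) : Prop :=
  IsAdmissible φ ∧
    ∀ u ∈ Ioo (0 : ℝ) 1, IsMaxOn (fun ψ : ℝ → ℝ => pathProb C ψ u) {ψ | IsAdmissible ψ} φ

/-- `γ`, as a path on `[0, 1]`, is the path of an admissible function. -/
def IsAdmissiblePath (γ : ℝ → ℝ × ℝ) : Prop :=
  ∃ φ, IsAdmissible φ ∧ EqOn γ (pathOf φ) (Icc 0 1)

/-- `γ`, as a path on `[0, 1]`, is the path of a function of maximal dependence for `C`. -/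
def IsPathOfMaximalDependence (C : ℝ → ℝ → ℝ) (γ : ℝ → ℝ × ℝ) : Prop :=
  ∃ φ, IsMaximalDependence C φ ∧ EqOn γ (pathOf φ) (Icc 0 1)

end TailDependence

end

namespace TailDependence

/-! Admissibility restricts `φ` near 0 only through limits, so the maximum is taken separately over
each hyperbola `p q = u²` in the unit square (`isMaximalDependence_iff`). At the endpoints of this
arc the copula equals `u²`. In the interior it lies strictly below `u²` for `ρ < 0`, equals it for
`ρ = 0`, and lies strictly above it for `ρ > 0`. For `ρ < 0` only endpoints could be maximal, but
the two limits keep both coordinates below 1 for small `u`. For `ρ > 0`, let `Φ(t) Φ(y) = u²`, `τ =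
√(1 - ρ²)`, and let `r = Φ'/Φ` be the reversed hazard rate. The derivative of `Φ₂(t, y; ρ)` along
the curve is `r(t)` times `Φ(t) Φ((y - ρt)/τ) - Φ(y) Φ((t - ρy)/τ)`. By
`stdNormalCDF_mul_conditional_lt` this is positive for `t < y`, so the copula strictly increases
towards the diagonal. That inequality rests on two facts about the normal law: `r` decreases, while
`r(x) + x` is positive and increases. -/

/-- The standard normal density. -/
noncomputable def stdNormalPDF (x : ℝ) : ℝ := gaussianPDFReal 0 1 x

/-! ### The standard normal density, distribution function and quantile. -/

lemma stdNormalPDF_eq (x : ℝ) :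
    stdNormalPDF x = (Real.sqrt (2 * Real.pi))⁻¹ * Real.exp (-(x ^ 2 / 2)) := by
  simp [stdNormalPDF, gaussianPDFReal, neg_div]

lemma stdNormalPDF_pos (x : ℝ) : 0 < stdNormalPDF x :=
  gaussianPDFReal_pos 0 1 x one_ne_zero

lemma integrable_stdNormalPDF : Integrable stdNormalPDF := integrable_gaussianPDFReal 0 1

lemma integral_stdNormalPDF : ∫ x, stdNormalPDF x = 1 :=
  integral_gaussianPDFReal_eq_one 0 one_ne_zero

lemma hasDerivAt_stdNormalPDF (x : ℝ) : HasDerivAt stdNormalPDF (-x * stdNormalPDF x) x := by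
  have h : HasDerivAt (fun x : ℝ => (Real.sqrt (2 * Real.pi))⁻¹ * Real.exp (-(x ^ 2 / 2)))
      ((Real.sqrt (2 * Real.pi))⁻¹ * (Real.exp (-(x ^ 2 / 2)) * (-(2 * x / 2)))) x := by
    refine HasDerivAt.const_mul _ (HasDerivAt.exp (HasDerivAt.fun_neg (HasDerivAt.div_const ?_ 2)))
    simpa using hasDerivAt_pow 2 x
  rw [show stdNormalPDF = _ from funext stdNormalPDF_eq]
  convert h using 1
  ring

lemma continuous_stdNormalPDF : Continuous stdNormalPDF :=
  continuous_iff_continuousAt.2 fun x => (hasDerivAt_stdNormalPDF x).continuousAt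

lemma cdf_gaussianReal_eq_integral (μ : ℝ) {v : NNReal} (hv : v ≠ 0) (x : ℝ) :
    cdf (gaussianReal μ v) x = ∫ t in Iic x, gaussianPDFReal μ v t := by
  rw [cdf_eq_real, measureReal_def, gaussianReal_apply_eq_integral μ hv, ENNReal.toReal_ofReal]
  exact integral_nonneg fun t => gaussianPDFReal_nonneg μ v t

lemma stdNormalCDF_eq_integral (x : ℝ) : stdNormalCDF x = ∫ t in Iic x, stdNormalPDF t :=
  cdf_gaussianReal_eq_integral 0 one_ne_zero x

lemma hasDerivAt_integral_Iic {f : ℝ → ℝ} (hf : Integrable f) (hc : Continuous f) (x : ℝ) :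
    HasDerivAt (fun x => ∫ t in Iic x, f t) (f x) x := by
  have h : (fun x => ∫ t in Iic x, f t) = fun x => (∫ t in Iic 0, f t) + ∫ t in (0 : ℝ)..x, f t := by
    ext x
    rw [← intervalIntegral.integral_Iic_sub_Iic hf.integrableOn hf.integrableOn]
    ring
  rw [h]
  exact (intervalIntegral.integral_hasDerivAt_right (hc.intervalIntegrable 0 x)
    (hc.stronglyMeasurableAtFilter _ _) hc.continuousAt).const_add _

lemma hasDerivAt_stdNormalCDF (x : ℝ) : HasDerivAt stdNormalCDF (stdNormalPDF x) x := by
  rw [show stdNormalCDF = _ from funext stdNormalCDF_eq_integral]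
  exact hasDerivAt_integral_Iic integrable_stdNormalPDF continuous_stdNormalPDF x

lemma continuous_stdNormalCDF : Continuous stdNormalCDF :=
  continuous_iff_continuousAt.2 fun x => (hasDerivAt_stdNormalCDF x).continuousAt

lemma strictMono_stdNormalCDF : StrictMono stdNormalCDF :=
  strictMono_of_hasDerivAt_pos hasDerivAt_stdNormalCDF stdNormalPDF_pos

lemma tendsto_stdNormalCDF_atBot : Tendsto stdNormalCDF atBot (𝓝 0) := tendsto_cdf_atBot _

lemma tendsto_stdNormalCDF_atTop : Tendsto stdNormalCDF atTop (𝓝 1) := tendsto_cdf_atTop _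

lemma stdNormalCDF_pos (x : ℝ) : 0 < stdNormalCDF x :=
  (cdf_nonneg _ (x - 1)).trans_lt (strictMono_stdNormalCDF (sub_one_lt x))

lemma stdNormalCDF_lt_one (x : ℝ) : stdNormalCDF x < 1 :=
  (strictMono_stdNormalCDF (lt_add_one x)).trans_le (cdf_le_one _ _)

lemma range_stdNormalCDF : range stdNormalCDF = Ioo 0 1 := by
  apply Subset.antisymm
  · rintro _ ⟨x, rfl⟩
    exact ⟨stdNormalCDF_pos x, stdNormalCDF_lt_one x⟩
  · intro p hp
    exact mem_range_of_exists_le_of_exists_ge continuous_stdNormalCDF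
      (((tendsto_stdNormalCDF_atBot.eventually_lt_const hp.1).exists).imp fun _ h => h.le)
      (((tendsto_stdNormalCDF_atTop.eventually_const_lt hp.2).exists).imp fun _ h => h.le)

lemma exists_stdNormalCDF_eq {p : ℝ} (hp : p ∈ Ioo (0 : ℝ) 1) : ∃ x, stdNormalCDF x = p := by
  rwa [← range_stdNormalCDF] at hp

lemma stdNormalQuantile_stdNormalCDF (x : ℝ) : stdNormalQuantile (stdNormalCDF x) = x := by
  have : {t : ℝ | stdNormalCDF x ≤ stdNormalCDF t} = Ici x := by
    ext t
    simp [strictMono_stdNormalCDF.le_iff_le]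
  rw [stdNormalQuantile, this]
  refine IsLeast.csInf_eq ⟨⟨x, self_mem_Ici, rfl⟩, ?_⟩
  rintro _ ⟨t, ht, rfl⟩
  exact EReal.coe_le_coe_iff.2 ht

lemma stdNormalQuantile_one : stdNormalQuantile 1 = ⊤ := by
  have : {t : ℝ | 1 ≤ stdNormalCDF t} = ∅ := by
    ext t
    simpa using stdNormalCDF_lt_one t
  rw [stdNormalQuantile, this, image_empty, sInf_empty]

/-! ### Decay at `-∞` and monotonicity of the reversed hazard rate. -/

lemma stdNormalPDF_le_exp (x : ℝ) : stdNormalPDF x ≤ Real.exp 1 * Real.exp x := by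
  have h1 : (Real.sqrt (2 * Real.pi))⁻¹ ≤ 1 := by
    apply inv_le_one_of_one_le₀
    rw [Real.one_le_sqrt]
    nlinarith [Real.pi_gt_three]
  rw [stdNormalPDF_eq, ← Real.exp_add]
  refine (mul_le_of_le_one_left (Real.exp_pos _).le h1).trans (Real.exp_le_exp.2 ?_)
  nlinarith [sq_nonneg (x + 1)]

lemma stdNormalCDF_le_exp (x : ℝ) : stdNormalCDF x ≤ Real.exp 1 * Real.exp x := by
  rw [stdNormalCDF_eq_integral, ← integral_exp_Iic x, ← integral_const_mul]
  exact setIntegral_mono integrable_stdNormalPDF.integrableOn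
    ((integrableOn_exp_Iic x).const_mul _) stdNormalPDF_le_exp

lemma tendsto_pow_mul_atBot_of_le_exp {f : ℝ → ℝ} (h0 : ∀ x, 0 ≤ f x) {c : ℝ}
    (h : ∀ x, f x ≤ c * Real.exp x) (n : ℕ) : Tendsto (fun x => x ^ n * f x) atBot (𝓝 0) := by
  have h1 : Tendsto (fun x : ℝ => c * ((-x) ^ n * Real.exp (-(-x)))) atBot (𝓝 0) := by
    simpa using ((Real.tendsto_pow_mul_exp_neg_atTop_nhds_zero n).comp
      tendsto_neg_atBot_atTop).const_mul c
  refine squeeze_zero_norm' ?_ h1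
  filter_upwards [eventually_le_atBot 0] with x hx
  rw [norm_mul, norm_pow, Real.norm_eq_abs, abs_of_nonpos hx, Real.norm_of_nonneg (h0 x), neg_neg]
  calc (-x) ^ n * f x ≤ (-x) ^ n * (c * Real.exp x) :=
        mul_le_mul_of_nonneg_left (h x) (pow_nonneg (by linarith) n)
    _ = _ := by ring

lemma tendsto_pow_mul_stdNormalPDF (n : ℕ) :
    Tendsto (fun x => x ^ n * stdNormalPDF x) atBot (𝓝 0) :=
  tendsto_pow_mul_atBot_of_le_exp (fun x => (stdNormalPDF_pos x).le) stdNormalPDF_le_exp n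

lemma tendsto_pow_mul_stdNormalCDF (n : ℕ) :
    Tendsto (fun x => x ^ n * stdNormalCDF x) atBot (𝓝 0) :=
  tendsto_pow_mul_atBot_of_le_exp (fun x => (stdNormalCDF_pos x).le) stdNormalCDF_le_exp n

/-- Drives the next three inequalities: the derivative of each left side (or difference) is, up to a
positive factor, the quantity shown positive just before, starting from `Φ > 0`, and all of them
vanish at `-∞`. -/
lemma pos_of_hasDerivAt_pos_of_tendsto_atBot {f f' : ℝ → ℝ} (hf : ∀ x, HasDerivAt f (f' x) x)
    (hf' : ∀ x, 0 < f' x) (h0 : Tendsto f atBot (𝓝 0)) (x : ℝ) : 0 < f x := by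
  have hm := strictMono_of_hasDerivAt_pos hf hf'
  exact (hm.monotone.le_of_tendsto h0 (x - 1)).trans_lt (hm (sub_one_lt x))

lemma stdNormalPDF_add_mul_stdNormalCDF_pos (x : ℝ) :
    0 < stdNormalPDF x + x * stdNormalCDF x := by
  refine pos_of_hasDerivAt_pos_of_tendsto_atBot (f := fun x => stdNormalPDF x + x * stdNormalCDF x)
    (fun x => ?_) stdNormalCDF_pos ?_ x
  · refine HasDerivAt.congr_deriv ((hasDerivAt_stdNormalPDF x).fun_add ((hasDerivAt_id' x).fun_mul
      (hasDerivAt_stdNormalCDF x))) ?_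
    ring
  · simpa using (tendsto_pow_mul_stdNormalPDF 0).add (tendsto_pow_mul_stdNormalCDF 1)

lemma one_add_sq_mul_stdNormalCDF_add_pos (x : ℝ) :
    0 < (1 + x ^ 2) * stdNormalCDF x + x * stdNormalPDF x := by
  refine pos_of_hasDerivAt_pos_of_tendsto_atBot (f := fun x => (1 + x ^ 2) * stdNormalCDF x + x * stdNormalPDF x)
    (fun x => ?_)
    (fun x => mul_pos two_pos (stdNormalPDF_add_mul_stdNormalCDF_pos x)) ?_ x
  · refine HasDerivAt.congr_deriv ((((hasDerivAt_pow 2 x).const_add 1).fun_mul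
      (hasDerivAt_stdNormalCDF x)).fun_add ((hasDerivAt_id' x).fun_mul (hasDerivAt_stdNormalPDF x))) ?_
    push_cast; ring
  · have := ((tendsto_pow_mul_stdNormalCDF 0).add (tendsto_pow_mul_stdNormalCDF 2)).add
      (tendsto_pow_mul_stdNormalPDF 1)
    simp only [add_zero] at this
    refine this.congr fun x => ?_
    ring

/-- Divided by `Φ²`, this says `r (r + x) < 1`, that is `r' > -1`. -/
lemma stdNormalPDF_mul_lt_stdNormalCDF_sq (x : ℝ) :
    stdNormalPDF x * (stdNormalPDF x + x * stdNormalCDF x) < stdNormalCDF x ^ 2 := by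
  rw [← sub_pos]
  refine pos_of_hasDerivAt_pos_of_tendsto_atBot (f := fun x => stdNormalCDF x ^ 2 -
    stdNormalPDF x * (stdNormalPDF x + x * stdNormalCDF x))
    (fun x => ?_)
    (fun x => mul_pos (stdNormalPDF_pos x) (one_add_sq_mul_stdNormalCDF_add_pos x)) ?_ x
  · have hd := hasDerivAt_stdNormalPDF x
    have hc := hasDerivAt_stdNormalCDF x
    refine ((hc.fun_pow 2).fun_sub
      (hd.fun_mul (hd.fun_add ((hasDerivAt_id' x).fun_mul hc)))).congr_deriv ?_
    push_cast; ring
  · have hd := tendsto_pow_mul_stdNormalPDF 0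
    have hc := tendsto_pow_mul_stdNormalCDF 0
    have := (hc.pow 2).sub (hd.mul (hd.add (tendsto_pow_mul_stdNormalCDF 1)))
    simpa using this

/-- The logarithmic derivative (reversed hazard rate) of the standard normal distribution. -/
noncomputable def reversedHazard (x : ℝ) : ℝ := stdNormalPDF x / stdNormalCDF x

lemma hasDerivAt_log_stdNormalCDF (x : ℝ) :
    HasDerivAt (fun x => Real.log (stdNormalCDF x)) (reversedHazard x) x :=
  (hasDerivAt_stdNormalCDF x).log (stdNormalCDF_pos x).ne'

lemma reversedHazard_pos (x : ℝ) : 0 < reversedHazard x :=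
  div_pos (stdNormalPDF_pos x) (stdNormalCDF_pos x)

lemma reversedHazard_add_pos (x : ℝ) : 0 < reversedHazard x + x := by
  have := div_pos (stdNormalPDF_add_mul_stdNormalCDF_pos x) (stdNormalCDF_pos x)
  rwa [add_div, mul_div_cancel_right₀ _ (stdNormalCDF_pos x).ne'] at this

lemma hasDerivAt_reversedHazard (x : ℝ) :
    HasDerivAt reversedHazard (-(reversedHazard x * (reversedHazard x + x))) x := by
  have h := stdNormalCDF_pos x
  rw [show reversedHazard = fun x => stdNormalPDF x / stdNormalCDF x from rfl]
  refine HasDerivAt.congr_deriv ((hasDerivAt_stdNormalPDF x).fun_div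
    (hasDerivAt_stdNormalCDF x) h.ne') ?_
  field_simp
  ring

lemma reversedHazard_strictAnti : StrictAnti reversedHazard :=
  strictAnti_of_hasDerivAt_neg hasDerivAt_reversedHazard fun x =>
    neg_neg_of_pos (mul_pos (reversedHazard_pos x) (reversedHazard_add_pos x))

lemma reversedHazard_add_strictMono : StrictMono fun x => reversedHazard x + x := by
  refine strictMono_of_hasDerivAt_pos
    (fun x => (hasDerivAt_reversedHazard x).fun_add (hasDerivAt_id' x)) fun x => ?_
  have h := stdNormalCDF_pos x
  have h1 : reversedHazard x * (reversedHazard x + x) =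
      stdNormalPDF x * (stdNormalPDF x + x * stdNormalCDF x) / stdNormalCDF x ^ 2 := by
    rw [reversedHazard]
    field_simp
  rw [neg_add_eq_sub, sub_pos, h1, div_lt_one (by positivity)]
  exact stdNormalPDF_mul_lt_stdNormalCDF_sq x

/-! ### The bivariate normal distribution function and its derivatives. -/

variable {ρ : ℝ}

lemma one_sub_sq_pos (hρ : ρ ∈ Ioo (-1 : ℝ) 1) : 0 < 1 - ρ ^ 2 := by
  nlinarith [hρ.1, hρ.2]

lemma cdf_gaussianReal (m : ℝ) {c : ℝ} (hc : 0 < c) (x : ℝ) :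
    cdf (gaussianReal m (.mk (c ^ 2) (sq_nonneg c))) x = stdNormalCDF ((x - m) / c) := by
  have h : gaussianReal m (.mk (c ^ 2) (sq_nonneg c)) =
      ((gaussianReal 0 1).map (c * ·)).map (· + m) := by
    rw [gaussianReal_map_const_mul, gaussianReal_map_add_const]
    simp
  rw [stdNormalCDF, cdf_eq_real, cdf_eq_real, h, Measure.map_map (by fun_prop) (by fun_prop),
    measureReal_def, Measure.map_apply (by fun_prop) measurableSet_Iic, measureReal_def]
  congr 2
  ext t
  simp only [mem_preimage, Function.comp_apply, mem_Iic]
  rw [le_div_iff₀ hc, le_sub_iff_add_le, mul_comm]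

lemma bivariateNormalDensity_nonneg (ρ x y : ℝ) : 0 ≤ bivariateNormalDensity ρ x y := by
  rw [bivariateNormalDensity]
  have := Real.pi_pos
  positivity

lemma bivariateNormalDensity_comm (ρ x y : ℝ) :
    bivariateNormalDensity ρ x y = bivariateNormalDensity ρ y x := by
  rw [bivariateNormalDensity, bivariateNormalDensity]
  congr 4
  ring

/-- Marginal times conditional density: given `x`, the other coordinate is normal with mean `ρx` and
variance `1 - ρ²`. The variance is kept as a square to match `cdf_gaussianReal`. -/
lemma bivariateNormalDensity_eq (hρ : ρ ∈ Ioo (-1 : ℝ) 1) (x y : ℝ) :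
    bivariateNormalDensity ρ x y = stdNormalPDF x *
      gaussianPDFReal (ρ * x) (.mk (√(1 - ρ ^ 2) ^ 2) (sq_nonneg _)) y := by
  have h := one_sub_sq_pos hρ
  have h2 : √(1 - ρ ^ 2) ^ 2 = 1 - ρ ^ 2 := Real.sq_sqrt h.le
  have hs := Real.sqrt_pos.2 h
  have hpi := Real.pi_pos
  rw [stdNormalPDF_eq, gaussianPDFReal_def, bivariateNormalDensity]
  simp only [NNReal.coe_mk]
  rw [mul_mul_mul_comm, ← Real.exp_add]
  congr 1
  · rw [Real.sqrt_mul (by positivity) (√(1 - ρ ^ 2) ^ 2), Real.sqrt_sq hs.le, ← mul_inv,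
      ← mul_assoc, Real.mul_self_sqrt (by positivity), one_div]
  · rw [h2]
    congr 1
    field_simp
    ring

lemma sqrt_one_sub_sq_pos (hρ : ρ ∈ Ioo (-1 : ℝ) 1) : 0 < √(1 - ρ ^ 2) :=
  Real.sqrt_pos.2 (one_sub_sq_pos hρ)

lemma sqrt_one_sub_sq_var_ne_zero (hρ : ρ ∈ Ioo (-1 : ℝ) 1) :
    NNReal.mk (√(1 - ρ ^ 2) ^ 2) (sq_nonneg _) ≠ 0 := by
  have := sqrt_one_sub_sq_pos hρ
  rw [ne_eq, ← NNReal.coe_eq_zero]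
  exact (pow_pos this 2).ne'

lemma integral_bivariateNormalDensity (hρ : ρ ∈ Ioo (-1 : ℝ) 1) (x : ℝ) :
    ∫ y, bivariateNormalDensity ρ x y = stdNormalPDF x := by
  simp_rw [bivariateNormalDensity_eq hρ]
  rw [integral_const_mul, integral_gaussianPDFReal_eq_one _ (sqrt_one_sub_sq_var_ne_zero hρ),
    mul_one]

lemma integral_Iic_bivariateNormalDensity (hρ : ρ ∈ Ioo (-1 : ℝ) 1) (x t : ℝ) :
    ∫ y in Iic t, bivariateNormalDensity ρ x y =
      stdNormalPDF x * stdNormalCDF ((t - ρ * x) / √(1 - ρ ^ 2)) := by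
  simp_rw [bivariateNormalDensity_eq hρ]
  rw [integral_const_mul, ← cdf_gaussianReal_eq_integral _ (sqrt_one_sub_sq_var_ne_zero hρ),
    cdf_gaussianReal _ (sqrt_one_sub_sq_pos hρ)]

lemma integrable_bivariateNormalDensity (hρ : ρ ∈ Ioo (-1 : ℝ) 1) :
    Integrable (Function.uncurry (bivariateNormalDensity ρ)) (volume.prod volume) := by
  have hm : Continuous (Function.uncurry (bivariateNormalDensity ρ)) := by
    unfold bivariateNormalDensity Function.uncurry
    fun_prop
  rw [integrable_prod_iff hm.aestronglyMeasurable]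
  refine ⟨Eventually.of_forall fun x => ?_, ?_⟩
  · simp only [Function.uncurry_apply_pair, bivariateNormalDensity_eq hρ]
    exact (integrable_gaussianPDFReal _ _).const_mul _
  · simp only [Function.uncurry_apply_pair, Real.norm_eq_abs,
      abs_of_nonneg (bivariateNormalDensity_nonneg ρ _ _), integral_bivariateNormalDensity hρ]
    exact integrable_stdNormalPDF

lemma bivariateNormalCDF_comm (hρ : ρ ∈ Ioo (-1 : ℝ) 1) (s t : EReal) :
    bivariateNormalCDF ρ s t = bivariateNormalCDF ρ t s := by
  rw [bivariateNormalCDF, bivariateNormalCDF, integral_integral_swap]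
  · simp_rw [bivariateNormalDensity_comm ρ]
  · rw [Measure.prod_restrict]
    exact (integrable_bivariateNormalDensity hρ).restrict

/-- The joint distribution function as an integral of conditional distribution functions. -/
lemma bivariateNormalCDF_coe (hρ : ρ ∈ Ioo (-1 : ℝ) 1) (x y : ℝ) :
    bivariateNormalCDF ρ x y =
      ∫ s in Iic x, stdNormalPDF s * stdNormalCDF ((y - ρ * s) / √(1 - ρ ^ 2)) := by
  simp only [bivariateNormalCDF, EReal.coe_le_coe_iff]
  exact integral_congr_ae (Eventually.of_forall fun s => integral_Iic_bivariateNormalDensity hρ s y)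

lemma bivariateNormalCDF_top_coe (hρ : ρ ∈ Ioo (-1 : ℝ) 1) (y : ℝ) :
    bivariateNormalCDF ρ ⊤ y =
      ∫ s, stdNormalPDF s * stdNormalCDF ((y - ρ * s) / √(1 - ρ ^ 2)) := by
  simp only [bivariateNormalCDF, EReal.coe_le_coe_iff, le_top, ofPred_true, Measure.restrict_univ]
  exact integral_congr_ae (Eventually.of_forall fun s => integral_Iic_bivariateNormalDensity hρ s y)

lemma bivariateNormalCDF_coe_top (hρ : ρ ∈ Ioo (-1 : ℝ) 1) (x : ℝ) :
    bivariateNormalCDF ρ x ⊤ = stdNormalCDF x := by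
  simp only [bivariateNormalCDF, EReal.coe_le_coe_iff, le_top, ofPred_true, Measure.restrict_univ,
    integral_bivariateNormalDensity hρ]
  exact (stdNormalCDF_eq_integral x).symm

lemma integral_conditional_stdNormalCDF (hρ : ρ ∈ Ioo (-1 : ℝ) 1) (y : ℝ) :
    ∫ s, stdNormalPDF s * stdNormalCDF ((y - ρ * s) / √(1 - ρ ^ 2)) = stdNormalCDF y := by
  rw [← bivariateNormalCDF_top_coe hρ, bivariateNormalCDF_comm hρ, bivariateNormalCDF_coe_top hρ]

lemma gaussianCopula_comm (hρ : ρ ∈ Ioo (-1 : ℝ) 1) (u v : ℝ) :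
    gaussianCopula ρ u v = gaussianCopula ρ v u :=
  bivariateNormalCDF_comm hρ _ _

lemma gaussianCopula_stdNormalCDF (ρ x y : ℝ) :
    gaussianCopula ρ (stdNormalCDF x) (stdNormalCDF y) = bivariateNormalCDF ρ x y := by
  simp only [gaussianCopula, stdNormalQuantile_stdNormalCDF]

lemma gaussianCopula_one_right (hρ : ρ ∈ Ioo (-1 : ℝ) 1) {u : ℝ} (hu : u ∈ Ioo (0 : ℝ) 1) :
    gaussianCopula ρ u 1 = u := by
  obtain ⟨x, rfl⟩ := exists_stdNormalCDF_eq hu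
  rw [gaussianCopula, stdNormalQuantile_one, stdNormalQuantile_stdNormalCDF,
    bivariateNormalCDF_coe_top hρ]

lemma gaussianCopula_one_left (hρ : ρ ∈ Ioo (-1 : ℝ) 1) {u : ℝ} (hu : u ∈ Ioo (0 : ℝ) 1) :
    gaussianCopula ρ 1 u = u := by
  rw [gaussianCopula_comm hρ, gaussianCopula_one_right hρ hu]

lemma continuous_conditional_stdNormalCDF (ρ y : ℝ) :
    Continuous fun s => stdNormalCDF ((y - ρ * s) / √(1 - ρ ^ 2)) :=
  continuous_stdNormalCDF.comp (by fun_prop)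

lemma integrable_stdNormalPDF_mul_stdNormalCDF {g : ℝ → ℝ} (hg : Continuous g) :
    Integrable fun s => stdNormalPDF s * stdNormalCDF (g s) := by
  refine integrable_stdNormalPDF.mul_bdd (c := 1)
    (continuous_stdNormalCDF.comp hg).aestronglyMeasurable (Eventually.of_forall fun s => ?_)
  rw [Real.norm_eq_abs, abs_of_pos (stdNormalCDF_pos _)]
  exact (stdNormalCDF_lt_one _).le

lemma hasDerivAt_bivariateNormalCDF_left (hρ : ρ ∈ Ioo (-1 : ℝ) 1) (x y : ℝ) :
    HasDerivAt (fun x : ℝ => bivariateNormalCDF ρ x y)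
      (stdNormalPDF x * stdNormalCDF ((y - ρ * x) / √(1 - ρ ^ 2))) x := by
  simp_rw [bivariateNormalCDF_coe hρ]
  exact hasDerivAt_integral_Iic (integrable_stdNormalPDF_mul_stdNormalCDF (by fun_prop))
    (continuous_stdNormalPDF.mul (continuous_conditional_stdNormalCDF ρ y)) x

lemma hasDerivAt_bivariateNormalCDF_right (hρ : ρ ∈ Ioo (-1 : ℝ) 1) (x y : ℝ) :
    HasDerivAt (fun y : ℝ => bivariateNormalCDF ρ x y)
      (stdNormalPDF y * stdNormalCDF ((x - ρ * y) / √(1 - ρ ^ 2))) y := by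
  simp_rw [bivariateNormalCDF_comm hρ (x : EReal)]
  exact hasDerivAt_bivariateNormalCDF_left hρ y x

/-- Both partial derivatives are jointly continuous, so the function is differentiable in the pair
and the chain rule applies. -/
lemma hasDerivAt_bivariateNormalCDF_curve (hρ : ρ ∈ Ioo (-1 : ℝ) 1) {f : ℝ → ℝ} {f' x : ℝ}
    (hf : HasDerivAt f f' x) :
    HasDerivAt (fun x : ℝ => bivariateNormalCDF ρ x (f x))
      (stdNormalPDF x * stdNormalCDF ((f x - ρ * x) / √(1 - ρ ^ 2)) +
        f' * (stdNormalPDF (f x) * stdNormalCDF ((x - ρ * f x) / √(1 - ρ ^ 2)))) x := by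
  have hd := continuous_stdNormalPDF
  have hc := continuous_stdNormalCDF
  have h := hasStrictFDerivAt_uncurry_coprod (𝕜 := ℝ) (u := (x, f x))
    (f := fun x y : ℝ => bivariateNormalCDF ρ x y)
    (f₁ := fun x y => ContinuousLinearMap.toSpanSingleton ℝ
      (stdNormalPDF x * stdNormalCDF ((y - ρ * x) / √(1 - ρ ^ 2))))
    (f₂ := fun x y => ContinuousLinearMap.toSpanSingleton ℝ
      (stdNormalPDF y * stdNormalCDF ((x - ρ * y) / √(1 - ρ ^ 2))))
    (Eventually.of_forall fun v => (hasDerivAt_bivariateNormalCDF_left hρ v.1 v.2).hasFDerivAt)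
    (Eventually.of_forall fun v => (hasDerivAt_bivariateNormalCDF_right hρ v.1 v.2).hasFDerivAt)
    (Continuous.continuousAt (by
      refine (ContinuousLinearMap.toSpanSingletonCLE (𝕜 := ℝ) (E := ℝ)).continuous.comp ?_
      fun_prop))
    (Continuous.continuousAt (by
      refine (ContinuousLinearMap.toSpanSingletonCLE (𝕜 := ℝ) (E := ℝ)).continuous.comp ?_
      fun_prop))
  have h2 := h.hasFDerivAt.comp_hasDerivAt x ((hasDerivAt_id' x).prodMk hf)
  refine h2.congr_deriv ?_
  simp [Function.HasUncurry.uncurry]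

lemma bivariateNormalCDF_zero (x y : ℝ) :
    bivariateNormalCDF 0 x y = stdNormalCDF x * stdNormalCDF y := by
  rw [bivariateNormalCDF_coe (by norm_num)]
  simp [integral_mul_const, stdNormalCDF_eq_integral x]

/-! ### Comparison with independence. -/

/-- Left of `c` only positive values have been collected; right of `c` the integral over `Iic x` is
minus that of the remaining negative tail. -/
lemma integral_Iic_pos_of_sign_change {f : ℝ → ℝ} (hf : Integrable f) (h0 : ∫ s, f s = 0) {c : ℝ}
    (hc : f c = 0) (hpos : ∀ s < c, 0 < f s) (hneg : ∀ s > c, f s < 0) (x : ℝ) :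
    0 < ∫ s in Iic x, f s := by
  rcases le_or_gt x c with hx | hx
  · rw [setIntegral_pos_iff_support_of_nonneg_ae _ hf.integrableOn]
    · refine lt_of_lt_of_le ?_ (measure_mono (s := Ioo (x - 1) x) fun s hs =>
        ⟨(hpos s (hs.2.trans_le hx)).ne', hs.2.le⟩)
      simp
    · refine (ae_restrict_iff' measurableSet_Iic).2 (Eventually.of_forall fun s hs => ?_)
      rcases (le_trans hs hx).lt_or_eq with h | rfl
      · exact (hpos s h).le
      · exact hc.ge
  · have hadd := intervalIntegral.integral_Iic_add_Ioi (b := x) hf.integrableOn hf.integrableOn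
    have : 0 < ∫ s in Ioi x, -f s := by
      rw [setIntegral_pos_iff_support_of_nonneg_ae _ hf.fun_neg.integrableOn]
      · refine lt_of_lt_of_le ?_ (measure_mono (s := Ioo x (x + 1)) fun s hs =>
          ⟨(neg_pos.2 (hneg s (hx.trans hs.1))).ne', hs.1⟩)
        simp
      · exact (ae_restrict_iff' measurableSet_Ioi).2 (Eventually.of_forall fun s hs =>
          (neg_pos.2 (hneg s (hx.trans hs))).le)
    rw [integral_neg] at this
    linarith

lemma integrable_conditional_sub (ρ y : ℝ) : Integrable fun s =>
    stdNormalPDF s * (stdNormalCDF ((y - ρ * s) / √(1 - ρ ^ 2)) - stdNormalCDF y) := by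
  simp_rw [mul_sub]
  exact (integrable_stdNormalPDF_mul_stdNormalCDF (by fun_prop)).sub
    (integrable_stdNormalPDF.mul_const _)

lemma integral_conditional_sub (hρ : ρ ∈ Ioo (-1 : ℝ) 1) (y : ℝ) : ∫ s,
    stdNormalPDF s * (stdNormalCDF ((y - ρ * s) / √(1 - ρ ^ 2)) - stdNormalCDF y) = 0 := by
  simp_rw [mul_sub]
  rw [integral_sub (integrable_stdNormalPDF_mul_stdNormalCDF (by fun_prop))
    (integrable_stdNormalPDF.mul_const _), integral_conditional_stdNormalCDF hρ,
    integral_mul_const, integral_stdNormalPDF, one_mul, sub_self]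

lemma integral_Iic_conditional_sub (hρ : ρ ∈ Ioo (-1 : ℝ) 1) (x y : ℝ) : ∫ s in Iic x,
    stdNormalPDF s * (stdNormalCDF ((y - ρ * s) / √(1 - ρ ^ 2)) - stdNormalCDF y) =
      bivariateNormalCDF ρ x y - stdNormalCDF x * stdNormalCDF y := by
  simp_rw [mul_sub]
  rw [integral_sub (integrable_stdNormalPDF_mul_stdNormalCDF (by fun_prop)).integrableOn
    (integrable_stdNormalPDF.mul_const _).integrableOn, integral_mul_const,
    ← stdNormalCDF_eq_integral, bivariateNormalCDF_coe hρ]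

lemma stdNormalCDF_mul_lt_bivariateNormalCDF (hρ : ρ ∈ Ioo (0 : ℝ) 1) (x y : ℝ) :
    stdNormalCDF x * stdNormalCDF y < bivariateNormalCDF ρ x y := by
  have hρ' : ρ ∈ Ioo (-1 : ℝ) 1 := ⟨by linarith [hρ.1], hρ.2⟩
  have hτ := sqrt_one_sub_sq_pos hρ'
  have h0 := hρ.1
  rw [← sub_pos, ← integral_Iic_conditional_sub hρ']
  -- This `c` solves `(y - ρc)/√(1 - ρ²) = y`; the conditional probability decreases in `s`, so it
  -- crosses `Φ(y)` only there.
  refine integral_Iic_pos_of_sign_change (c := (1 - √(1 - ρ ^ 2)) * y / ρ)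
    (integrable_conditional_sub ρ y) (integral_conditional_sub hρ' y) ?_ (fun s hs => ?_)
    (fun s hs => ?_) x
  · rw [mul_eq_zero, sub_eq_zero]
    right
    congr 1
    field_simp
    ring
  · refine mul_pos (stdNormalPDF_pos s) (sub_pos.2 (strictMono_stdNormalCDF ?_))
    rw [lt_div_iff₀ h0] at hs
    rw [lt_div_iff₀ hτ]
    linarith
  · refine mul_neg_of_pos_of_neg (stdNormalPDF_pos s) (sub_neg.2 (strictMono_stdNormalCDF ?_))
    rw [gt_iff_lt, div_lt_iff₀ h0] at hs
    rw [div_lt_iff₀ hτ]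
    linarith

lemma bivariateNormalCDF_lt_stdNormalCDF_mul (hρ : ρ ∈ Ioo (-1 : ℝ) 0) (x y : ℝ) :
    bivariateNormalCDF ρ x y < stdNormalCDF x * stdNormalCDF y := by
  have hρ' : ρ ∈ Ioo (-1 : ℝ) 1 := ⟨hρ.1, by linarith [hρ.2]⟩
  have hτ := sqrt_one_sub_sq_pos hρ'
  have h0 := hρ.2
  rw [← sub_neg, ← integral_Iic_conditional_sub hρ', ← neg_pos, ← integral_neg]
  refine integral_Iic_pos_of_sign_change (c := (1 - √(1 - ρ ^ 2)) * y / ρ)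
    (integrable_conditional_sub ρ y).fun_neg ?_ ?_ (fun s hs => ?_)
    (fun s hs => ?_) x
  · rw [integral_neg, integral_conditional_sub hρ' y, neg_zero]
  · rw [neg_eq_zero, mul_eq_zero, sub_eq_zero]
    right
    congr 1
    have := h0.ne
    field_simp
    ring
  · rw [neg_pos]
    refine mul_neg_of_pos_of_neg (stdNormalPDF_pos s) (sub_neg.2 (strictMono_stdNormalCDF ?_))
    rw [lt_div_iff_of_neg h0] at hs
    rw [div_lt_iff₀ hτ]
    linarith
  · rw [neg_neg_iff_pos]
    refine mul_pos (stdNormalPDF_pos s) (sub_pos.2 (strictMono_stdNormalCDF ?_))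
    rw [gt_iff_lt, div_lt_iff_of_neg h0] at hs
    rw [lt_div_iff₀ hτ]
    linarith

/-! ### Strict increase along a hyperbola towards the diagonal. -/

lemma reversedHazard_mul_lt (hρ : ρ ∈ Ioo (0 : ℝ) 1) {x y : ℝ} (hxy : x ≤ y) :
    √(1 - ρ ^ 2) * reversedHazard y < reversedHazard ((y - ρ * x) / √(1 - ρ ^ 2)) +
      ρ * reversedHazard ((x - ρ * y) / √(1 - ρ ^ 2)) := by
  have hρ' : ρ ∈ Ioo (-1 : ℝ) 1 := ⟨by linarith [hρ.1], hρ.2⟩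
  have h0 := hρ.1
  have hτ := sqrt_one_sub_sq_pos hρ'
  have hsq : √(1 - ρ ^ 2) ^ 2 = 1 - ρ ^ 2 := Real.sq_sqrt (one_sub_sq_pos hρ').le
  have hτ1 : √(1 - ρ ^ 2) < 1 := by nlinarith
  set τ := √(1 - ρ ^ 2)
  have hab : (y - ρ * x) / τ + ρ * ((x - ρ * y) / τ) = τ * y := by
    field_simp
    rw [hsq]
    ring
  have hba : (x - ρ * y) / τ ≤ (y - ρ * x) / τ := by
    gcongr ?_ / τ
    nlinarith
  set a := (y - ρ * x) / τ
  set b := (x - ρ * y) / τ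
  -- If `y ≤ a`, bounding `r(a) + a` below by `r(y) + y` and `r(b) + b` by 0 and using `a + ρb = τy`
  -- leaves `(1 - τ)(r(y) + y) > 0`. If `a < y`, then also `b < y`, so both hazards exceed `r(y)`,
  -- and `1 + ρ > τ`.
  rcases le_or_gt y a with h | h
  · have h1 : reversedHazard y + y ≤ reversedHazard a + a := reversedHazard_add_strictMono.monotone h
    have h2 := reversedHazard_add_pos y
    have h3 := mul_pos h0 (reversedHazard_add_pos b)
    nlinarith
  · have h1 := reversedHazard_strictAnti h
    have h2 := reversedHazard_strictAnti (hba.trans_lt h)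
    have h3 := reversedHazard_pos y
    nlinarith

/-- On `x < y`, conditioning on the smaller coordinate increases the ratio
`P(Y ≤ y | X = x) / P(Y ≤ y)` more than exchanging the roles of `x` and `y` does. -/
lemma stdNormalCDF_mul_conditional_lt (hρ : ρ ∈ Ioo (0 : ℝ) 1) {x y : ℝ} (hxy : x < y) :
    stdNormalCDF y * stdNormalCDF ((x - ρ * y) / √(1 - ρ ^ 2)) <
      stdNormalCDF x * stdNormalCDF ((y - ρ * x) / √(1 - ρ ^ 2)) := by
  have hρ' : ρ ∈ Ioo (-1 : ℝ) 1 := ⟨by linarith [hρ.1], hρ.2⟩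
  have hτ := sqrt_one_sub_sq_pos hρ'
  set τ := √(1 - ρ ^ 2) with hτdef
  -- The claim in logarithms, with `y` replaced by a variable `t`: at `t = x` the first two terms
  -- cancel and `-log Φ(x)` remains, so it suffices that this function increases on `[x, y]`.
  have hd (t : ℝ) : HasDerivAt (fun t => Real.log (stdNormalCDF ((t - ρ * x) / τ)) -
      Real.log (stdNormalCDF ((x - ρ * t) / τ)) - Real.log (stdNormalCDF t))
      ((reversedHazard ((t - ρ * x) / τ) + ρ * reversedHazard ((x - ρ * t) / τ) -
        τ * reversedHazard t) / τ) t := by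
    have h1 : HasDerivAt (fun t => (t - ρ * x) / τ) (1 / τ) t :=
      ((hasDerivAt_id' t).sub_const _).div_const τ
    have h2 : HasDerivAt (fun t => (x - ρ * t) / τ) (-(ρ * 1) / τ) t :=
      (((hasDerivAt_id' t).const_mul ρ).const_sub x).div_const τ
    refine ((((hasDerivAt_log_stdNormalCDF _).comp t h1).fun_sub
      ((hasDerivAt_log_stdNormalCDF _).comp t h2)).fun_sub
      (hasDerivAt_log_stdNormalCDF t)).congr_deriv ?_
    field_simp
    ring
  have hm := strictMonoOn_of_deriv_pos (convex_Ici x)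
    (fun t _ => (hd t).continuousAt.continuousWithinAt) fun t ht => by
      rw [(hd t).deriv]
      exact div_pos (sub_pos.2 (reversedHazard_mul_lt hρ (interior_subset ht))) hτ
  have h := hm self_mem_Ici hxy.le hxy
  have p1 := stdNormalCDF_pos x
  have p2 := stdNormalCDF_pos y
  have p3 := stdNormalCDF_pos ((x - ρ * y) / τ)
  have p4 := stdNormalCDF_pos ((y - ρ * x) / τ)
  rw [← Real.log_lt_log_iff (by positivity) (by positivity), Real.log_mul p2.ne' p3.ne',
    Real.log_mul p1.ne' p4.ne']
  dsimp only at h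
  linarith

/-- A real-valued inverse for calculus, since `stdNormalQuantile` takes values in `EReal`. -/
lemma exists_hasDerivAt_stdNormalCDF_inverse : ∃ Ψ : ℝ → ℝ, ∀ p ∈ Ioo (0 : ℝ) 1,
    stdNormalCDF (Ψ p) = p ∧ HasDerivAt Ψ (stdNormalPDF (Ψ p))⁻¹ p := by
  have he : IsOpenEmbedding stdNormalCDF :=
    ⟨strictMono_stdNormalCDF.isEmbedding_of_ordConnected
      (range_stdNormalCDF ▸ ordConnected_Ioo), range_stdNormalCDF ▸ isOpen_Ioo⟩
  refine ⟨(he.toOpenPartialHomeomorph stdNormalCDF).symm, fun p hp => ?_⟩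
  have hp' : p ∈ (he.toOpenPartialHomeomorph stdNormalCDF).target := by
    simpa [range_stdNormalCDF] using hp
  exact ⟨(he.toOpenPartialHomeomorph stdNormalCDF).right_inv hp',
    (he.toOpenPartialHomeomorph stdNormalCDF).hasDerivAt_symm hp' (stdNormalPDF_pos _).ne'
      (hasDerivAt_stdNormalCDF _)⟩

lemma bivariateNormalCDF_lt_diagonal (hρ : ρ ∈ Ioo (0 : ℝ) 1) {x y z : ℝ} (hxz : x < z)
    (h : stdNormalCDF x * stdNormalCDF y = stdNormalCDF z ^ 2) :
    bivariateNormalCDF ρ x y < bivariateNormalCDF ρ z z := by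
  have hρ' : ρ ∈ Ioo (-1 : ℝ) 1 := ⟨by linarith [hρ.1], hρ.2⟩
  obtain ⟨Ψ, hΨ⟩ := exists_hasDerivAt_stdNormalCDF_inverse
  set q : ℝ → ℝ := fun t => stdNormalCDF z ^ 2 / stdNormalCDF t with hq
  have hqmem : ∀ t ∈ Icc x z, q t ∈ Ioo (0 : ℝ) 1 := by
    intro t ht
    have p1 := stdNormalCDF_pos t
    refine ⟨div_pos (pow_pos (stdNormalCDF_pos z) 2) p1, ?_⟩
    rw [hq, div_lt_one p1, ← h]
    exact (mul_lt_of_lt_one_right (stdNormalCDF_pos x) (stdNormalCDF_lt_one y)).trans_le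
      (strictMono_stdNormalCDF.monotone ht.1)
  have hΨq : ∀ t ∈ Icc x z, stdNormalCDF (Ψ (q t)) = q t := fun t ht => (hΨ _ (hqmem t ht)).1
  have hd : ∀ t ∈ Icc x z, HasDerivAt (fun t : ℝ => bivariateNormalCDF ρ t (Ψ (q t)))
      (reversedHazard t * (stdNormalCDF t * stdNormalCDF ((Ψ (q t) - ρ * t) / √(1 - ρ ^ 2)) -
        stdNormalCDF (Ψ (q t)) * stdNormalCDF ((t - ρ * Ψ (q t)) / √(1 - ρ ^ 2)))) t := by
    intro t ht
    have p1 := (stdNormalCDF_pos t).ne'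
    have p2 := (stdNormalPDF_pos (Ψ (q t))).ne'
    have hqd := (hasDerivAt_const t (stdNormalCDF z ^ 2)).fun_div (hasDerivAt_stdNormalCDF t) p1
    refine (hasDerivAt_bivariateNormalCDF_curve hρ'
      (((hΨ _ (hqmem t ht)).2).comp t hqd)).congr_deriv ?_
    rw [hΨq t ht, reversedHazard]
    simp only [Function.comp_apply, hq] at p2 ⊢
    field_simp
    ring
  have hm := strictMonoOn_of_deriv_pos (convex_Icc x z)
    (fun t ht => (hd t ht).continuousAt.continuousWithinAt) fun t ht => by
      have ht' := interior_subset ht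
      rw [interior_Icc] at ht
      rw [(hd t ht').deriv]
      refine mul_pos (reversedHazard_pos t) (sub_pos.2 (stdNormalCDF_mul_conditional_lt hρ ?_))
      have hlt := strictMono_stdNormalCDF ht.2
      -- Before the diagonal, `t < z < Ψ (q t)`: the two coordinates lie on opposite sides of `z`.
      refine ht.2.trans (strictMono_stdNormalCDF.lt_iff_lt.1 ?_)
      rw [hΨq t ht', hq, lt_div_iff₀ (stdNormalCDF_pos t), sq]
      exact mul_lt_mul_of_pos_left hlt (stdNormalCDF_pos z)
  have hx : Ψ (q x) = y := by
    apply strictMono_stdNormalCDF.injective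
    rw [hΨq x ⟨le_rfl, hxz.le⟩, hq, ← h]
    exact mul_div_cancel_left₀ _ (stdNormalCDF_pos x).ne'
  have hz : Ψ (q z) = z := by
    apply strictMono_stdNormalCDF.injective
    rw [hΨq z ⟨hxz.le, le_rfl⟩, hq, sq]
    exact mul_div_cancel_left₀ _ (stdNormalCDF_pos z).ne'
  simpa only [hx, hz] using hm ⟨le_rfl, hxz.le⟩ ⟨hxz.le, le_rfl⟩ hxz

/-! ### Transfer to the copula. -/

lemma gaussianCopula_zero {u v : ℝ} (hu : u ∈ Ioc (0 : ℝ) 1) (hv : v ∈ Ioc (0 : ℝ) 1)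
    (huv : u * v < 1) : gaussianCopula 0 u v = u * v := by
  have h0 : (0 : ℝ) ∈ Ioo (-1 : ℝ) 1 := by norm_num
  rcases hu.2.eq_or_lt with rfl | hu1
  · rw [one_mul] at huv ⊢
    exact gaussianCopula_one_left h0 ⟨hv.1, huv⟩
  rcases hv.2.eq_or_lt with rfl | hv1
  · rw [gaussianCopula_one_right h0 ⟨hu.1, hu1⟩, mul_one]
  obtain ⟨x, rfl⟩ := exists_stdNormalCDF_eq ⟨hu.1, hu1⟩
  obtain ⟨y, rfl⟩ := exists_stdNormalCDF_eq ⟨hv.1, hv1⟩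
  rw [gaussianCopula_stdNormalCDF, bivariateNormalCDF_zero]

lemma mul_lt_gaussianCopula (hρ : ρ ∈ Ioo (0 : ℝ) 1) {u v : ℝ} (hu : u ∈ Ioo (0 : ℝ) 1)
    (hv : v ∈ Ioo (0 : ℝ) 1) : u * v < gaussianCopula ρ u v := by
  obtain ⟨x, rfl⟩ := exists_stdNormalCDF_eq hu
  obtain ⟨y, rfl⟩ := exists_stdNormalCDF_eq hv
  rw [gaussianCopula_stdNormalCDF]
  exact stdNormalCDF_mul_lt_bivariateNormalCDF hρ x y

lemma gaussianCopula_lt_mul (hρ : ρ ∈ Ioo (-1 : ℝ) 0) {u v : ℝ} (hu : u ∈ Ioo (0 : ℝ) 1)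
    (hv : v ∈ Ioo (0 : ℝ) 1) : gaussianCopula ρ u v < u * v := by
  obtain ⟨x, rfl⟩ := exists_stdNormalCDF_eq hu
  obtain ⟨y, rfl⟩ := exists_stdNormalCDF_eq hv
  rw [gaussianCopula_stdNormalCDF]
  exact bivariateNormalCDF_lt_stdNormalCDF_mul hρ x y

lemma gaussianCopula_lt_diagonal_of_lt (hρ : ρ ∈ Ioo (0 : ℝ) 1) {u p q : ℝ}
    (hu : u ∈ Ioo (0 : ℝ) 1) (hp : 0 < p) (hpu : p < u) (hq : q ≤ 1) (hpq : p * q = u ^ 2) :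
    gaussianCopula ρ p q < gaussianCopula ρ u u := by
  have hp1 : p < 1 := hpu.trans hu.2
  have hq0 : 0 < q := pos_of_mul_pos_right (hpq ▸ pow_pos hu.1 2) hp.le
  -- At `q = 1` the quantile is infinite and the calculus argument does not apply; there the copula
  -- is `p = u²`, which is below the diagonal value by comparison with independence.
  rcases hq.eq_or_lt with rfl | hq1
  · rw [gaussianCopula_one_right ⟨by linarith [hρ.1], hρ.2⟩ ⟨hp, hp1⟩]
    rw [mul_one, sq] at hpq
    exact hpq ▸ mul_lt_gaussianCopula hρ hu hu
  · obtain ⟨x, rfl⟩ := exists_stdNormalCDF_eq ⟨hp, hp1⟩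
    obtain ⟨y, rfl⟩ := exists_stdNormalCDF_eq ⟨hq0, hq1⟩
    obtain ⟨z, rfl⟩ := exists_stdNormalCDF_eq hu
    rw [gaussianCopula_stdNormalCDF, gaussianCopula_stdNormalCDF]
    exact bivariateNormalCDF_lt_diagonal hρ (strictMono_stdNormalCDF.lt_iff_lt.1 hpu) hpq

/-- For positive correlation, the diagonal point is the strict maximizer of the copula on
each hyperbola `p q = u²`. -/
lemma gaussianCopula_lt_diagonal (hρ : ρ ∈ Ioo (0 : ℝ) 1) {u p q : ℝ} (hu : u ∈ Ioo (0 : ℝ) 1)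
    (hp : p ∈ Ioc (0 : ℝ) 1) (hq : q ≤ 1) (hpq : p * q = u ^ 2) (hne : p ≠ u) :
    gaussianCopula ρ p q < gaussianCopula ρ u u := by
  rcases hne.lt_or_gt with h | h
  · exact gaussianCopula_lt_diagonal_of_lt hρ hu hp.1 h hq hpq
  · have hq0 : 0 < q := pos_of_mul_pos_right (hpq ▸ pow_pos hu.1 2) hp.1.le
    rw [gaussianCopula_comm ⟨by linarith [hρ.1], hρ.2⟩]
    refine gaussianCopula_lt_diagonal_of_lt hρ hu hq0 ?_ hp.2 (mul_comm q p ▸ hpq)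
    nlinarith [hu.1]

/-! ### Admissible functions and maximal dependence. -/

lemma mem_Ioc_of_mem_Icc_sq {u v : ℝ} (hu : 0 < u) (hv : v ∈ Icc (u ^ 2) 1) :
    v ∈ Ioc (0 : ℝ) 1 ∧ u ^ 2 / v ∈ Ioc (0 : ℝ) 1 := by
  have h : 0 < v := (pow_pos hu 2).trans_le hv.1
  exact ⟨⟨h, hv.2⟩, div_pos (pow_pos hu 2) h, (div_le_one h).2 hv.1⟩

lemma isAdmissible_id : IsAdmissible fun u => u where
  mem_Icc u hu := ⟨by nlinarith [hu.1, hu.2], hu.2⟩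
  tendsto_fst := tendsto_nhdsWithin_of_tendsto_nhds tendsto_id
  tendsto_snd := by
    simp_rw [sq, mul_self_div_self]
    exact tendsto_nhdsWithin_of_tendsto_nhds tendsto_id

/-- The limits see only the germ at 0, so one value at `u > 0` can be changed freely; this makes the
maximization pointwise. -/
lemma IsAdmissible.update {φ : ℝ → ℝ} (hφ : IsAdmissible φ) {u v : ℝ} (hu : 0 < u)
    (hv : v ∈ Icc (u ^ 2) 1) : IsAdmissible (Function.update φ u v) := by
  have h : ∀ᶠ t in 𝓝[>] (0 : ℝ), φ t = Function.update φ u v t := by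
    filter_upwards [nhdsWithin_le_nhds (eventually_ne_nhds hu.ne)] with t ht
    rw [Function.update_of_ne ht]
  refine ⟨fun t ht => ?_, hφ.tendsto_fst.congr' h, hφ.tendsto_snd.congr' ?_⟩
  · rcases eq_or_ne t u with rfl | htu
    · rwa [Function.update_self]
    · rw [Function.update_of_ne htu]
      exact hφ.mem_Icc t ht
  · filter_upwards [h] with t ht
    rw [ht]

lemma isMaximalDependence_iff {C : ℝ → ℝ → ℝ} {φ : ℝ → ℝ} : IsMaximalDependence C φ ↔
    IsAdmissible φ ∧ ∀ u ∈ Ioo (0 : ℝ) 1, ∀ v ∈ Icc (u ^ 2) 1,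
      C v (u ^ 2 / v) ≤ C (φ u) (u ^ 2 / φ u) := by
  refine and_congr_right fun hφ => forall₂_congr fun u hu => ⟨fun h v hv => ?_, fun h ψ hψ => ?_⟩
  · simpa only [pathProb, mem_ofPred_eq, Function.update_self] using h (hφ.update hu.1 hv)
  · exact h _ (hψ.mem_Icc u ⟨hu.1.le, hu.2.le⟩)

theorem not_isMaximalDependence_gaussianCopula_of_neg (hρ : ρ ∈ Ioo (-1 : ℝ) 0) (φ : ℝ → ℝ) :
    ¬ IsMaximalDependence (gaussianCopula ρ) φ := by
  rw [isMaximalDependence_iff]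
  rintro ⟨hφ, hmax⟩
  obtain ⟨u, h1, h2, hu⟩ := ((hφ.tendsto_fst.eventually_lt_const one_pos).and
    ((hφ.tendsto_snd.eventually_lt_const one_pos).and
      (Ioo_mem_nhdsGT (zero_lt_one (α := ℝ))))).exists
  obtain ⟨⟨hp, -⟩, hq, -⟩ := mem_Ioc_of_mem_Icc_sq hu.1 (hφ.mem_Icc u ⟨hu.1.le, hu.2.le⟩)
  have hlt := gaussianCopula_lt_mul hρ ⟨hp, h1⟩ ⟨hq, h2⟩
  -- The competitor is the endpoint `(1, u²)`, where the copula equals `u²`.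
  have hle := hmax u hu 1 ⟨pow_le_one₀ hu.1.le hu.2.le, le_rfl⟩
  rw [div_one, gaussianCopula_one_left ⟨hρ.1, by linarith [hρ.2]⟩
    ⟨pow_pos hu.1 2, pow_lt_one₀ hu.1.le hu.2 two_ne_zero⟩] at hle
  rw [mul_div_cancel₀ _ hp.ne'] at hlt
  exact hle.not_gt hlt

theorem IsAdmissible.isMaximalDependence_gaussianCopula_zero {φ : ℝ → ℝ} (hφ : IsAdmissible φ) :
    IsMaximalDependence (gaussianCopula 0) φ := by
  refine isMaximalDependence_iff.2 ⟨hφ, fun u hu v hv => ?_⟩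
  have key : ∀ w ∈ Icc (u ^ 2) 1, gaussianCopula 0 w (u ^ 2 / w) = u ^ 2 := by
    intro w hw
    obtain ⟨hp, hq⟩ := mem_Ioc_of_mem_Icc_sq hu.1 hw
    have h := mul_div_cancel₀ (u ^ 2) hp.1.ne'
    rw [gaussianCopula_zero hp hq (h.trans_lt (pow_lt_one₀ hu.1.le hu.2 two_ne_zero)), h]
  rw [key v hv, key _ (hφ.mem_Icc u ⟨hu.1.le, hu.2.le⟩)]

theorem isMaximalDependence_gaussianCopula_id (hρ : ρ ∈ Ioo (0 : ℝ) 1) :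
    IsMaximalDependence (gaussianCopula ρ) fun u => u := by
  refine isMaximalDependence_iff.2 ⟨isAdmissible_id, fun u hu v hv => ?_⟩
  rcases eq_or_ne v u with rfl | hne
  · rfl
  obtain ⟨hp, hq⟩ := mem_Ioc_of_mem_Icc_sq hu.1 hv
  rw [sq u, mul_self_div_self, ← sq]
  exact (gaussianCopula_lt_diagonal hρ hu hp hq.2 (mul_div_cancel₀ _ hp.1.ne') hne).le

theorem IsMaximalDependence.eq_of_gaussianCopula {φ : ℝ → ℝ} (hρ : ρ ∈ Ioo (0 : ℝ) 1)
    (h : IsMaximalDependence (gaussianCopula ρ) φ) {u : ℝ} (hu : u ∈ Ioc (0 : ℝ) 1) :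
    φ u = u := by
  obtain ⟨hφ, hmax⟩ := isMaximalDependence_iff.1 h
  have hmem := hφ.mem_Icc u ⟨hu.1.le, hu.2⟩
  -- Maximality says nothing at `u = 1`, but there `[u², 1]` is the single point 1.
  rcases hu.2.eq_or_lt with rfl | hu1
  · rw [one_pow] at hmem
    exact le_antisymm hmem.2 hmem.1
  by_contra hne
  obtain ⟨hp, hq⟩ := mem_Ioc_of_mem_Icc_sq hu.1 hmem
  have hle := hmax u ⟨hu.1, hu1⟩ u ⟨by nlinarith [hu.1], hu.2⟩
  rw [sq u, mul_self_div_self, ← sq] at hle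
  exact hle.not_gt
    (gaussianCopula_lt_diagonal hρ ⟨hu.1, hu1⟩ hp hq.2 (mul_div_cancel₀ _ hp.1.ne') hne)

end TailDependence

theorem theorem1 (ρ : ℝ) :
    (ρ ∈ Set.Ioo (-1 : ℝ) 0 →
      ¬ ∃ γ : ℝ → ℝ × ℝ,
        TailDependence.IsPathOfMaximalDependence (TailDependence.gaussianCopula ρ) γ) ∧
    (ρ = 0 →
      ∀ γ : ℝ → ℝ × ℝ, TailDependence.IsAdmissiblePath γ →
        TailDependence.IsPathOfMaximalDependence (TailDependence.gaussianCopula ρ) γ) ∧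
    (ρ ∈ Set.Ioo (0 : ℝ) 1 →
      TailDependence.IsPathOfMaximalDependence (TailDependence.gaussianCopula ρ)
        (fun u => (u, u)) ∧
      ∀ γ : ℝ → ℝ × ℝ,
        TailDependence.IsPathOfMaximalDependence (TailDependence.gaussianCopula ρ) γ →
          Set.EqOn γ (fun u => (u, u)) (Set.Ioc 0 1)) := by
  refine ⟨?_, ?_, fun hρ => ⟨⟨fun u => u,
    TailDependence.isMaximalDependence_gaussianCopula_id hρ, fun u _ => ?_⟩, ?_⟩⟩
  · rintro hρ ⟨γ, φ, hφ, -⟩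
    exact TailDependence.not_isMaximalDependence_gaussianCopula_of_neg hρ φ hφ
  · rintro rfl γ ⟨φ, hφ, hγ⟩
    exact ⟨φ, hφ.isMaximalDependence_gaussianCopula_zero, hγ⟩
  · simp only [TailDependence.pathOf, sq, mul_self_div_self]
  · rintro γ ⟨φ, hφ, hγ⟩ u hu
    rw [hγ ⟨hu.1.le, hu.2⟩, TailDependence.pathOf, hφ.eq_of_gaussianCopula hρ hu, sq,
      mul_self_div_self]
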